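/- Let $\Omega$ be a compact Hausdorff space (for instance a compact subset of $\mathbb{R}^d$), let $C(\Omega)$ be the Banach space of continuous functions $\Omega\to\mathbb{R}$ with the supremum norm, and let $\mathcal{M}(\Omega)=C(\Omega)'$ be the space of signed Radon measures on $\Omega$, i.e. the continuous dual of $C(\Omega)$ with the dual norm $\|f\|_{\mathcal{M}}=\sup_{\|\varphi\|_\infty\le 1}\langle f,\varphi\rangle$. For $x\in\Omega$ let $\delta(\cdot-x)\in\mathcal{M}(\Omega)$ denote the Dirac impulse $\varphi\mapsto\varphi(x)$. Let $\nu_1,\dots,\nu_M\in C(\Omega)$ and $\boldsymbol\nu(f)=(\langle \nu_1,f\rangle,\dots,\langle\nu_M,f\rangle)\in\mathbb{R}^M$ for $f\in\mathcal{M}(\Omega)$. Let $E:\mathbb{R}^M\times\mathbb{R}^M\to[0,+\infty]$, $y\in\mathbb{R}^M$ and $\lambda>0$, where $z\mapsto E(y,z)$ is convex and lower semicontinuous, and let $$S=\arg\min_{f\in\mathcal{M}(\Omega)}\Big(E\big(y,\boldsymbol\nu(f)\big)+\lambda\|f\|_{\mathcal{M}}\Big)$$ be the set of global minimizers (all of $\mathcal{M}(\Omega)$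 if the cost is identically $+\infty$). Then: 1. every extreme point of $S$ is of the form $\sum_{k=1}^{K_0}a_k\,\delta(\cdot-x_k)$ with $0\le K_0\le M$, $a_k\in\mathbb{R}$ and $x_k\in\Omega$; 2. if $E(y,\boldsymbol\nu(f))<\infty$ for at least one $f\in\mathcal{M}(\Omega)$ (which holds, e.g., if $\nu_1,\dots,\nu_M$ are linearly independent and $E(y,\cdot)$ is not identically $+\infty$), then $S$ has at least one extreme point; 3. there is a minimizer $f_0\in S$ of the form $f_0=\sum_{k=1}^{K_0}a_k\,\delta(\cdot-x_k)$ with $0\le K_0\le M$, $a_k\in\mathbb{R}$ and $x_k\in\Omega$. -/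

import Mathlib

open scoped ENNReal NNReal

noncomputable section

namespace Spikes

/-- The space `M(Ω)` of signed Radon measures on a compact space `Ω`, as the continuous dual of
`C(Ω)` (with the supremum norm). Its norm is the dual norm, i.e. the total variation. -/
abbrev RadonSpace (Ω : Type*) [TopologicalSpace Ω] [CompactSpace Ω] : Type _ :=
  StrongDual ℝ C(Ω, ℝ)

variable {Ω : Type*} [TopologicalSpace Ω] [CompactSpace Ω] {M : ℕ}

/-- The Dirac impulse `δ(· - x)`, i.e. the functional `φ ↦ φ x`. -/
def dirac (x : Ω) : RadonSpace Ω := ContinuousMap.evalCLM ℝ x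

theorem dirac_apply (x : Ω) (φ : C(Ω, ℝ)) : dirac x φ = φ x := rfl

/-- The measurement operator `f ↦ (⟨ν₁, f⟩, …, ⟨ν_M, f⟩)`. -/
def measure (ν : Fin M → C(Ω, ℝ)) (f : RadonSpace Ω) : Fin M → ℝ := fun m => f (ν m)

/-- The cost `E(y, ν(f)) + lam * ‖f‖`, with values in `[0, ∞]`. -/
def cost (E : (Fin M → ℝ) → (Fin M → ℝ) → ℝ≥0∞) (y : Fin M → ℝ) (ν : Fin M → C(Ω, ℝ))
    (lam : ℝ) (f : RadonSpace Ω) : ℝ≥0∞ :=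
  E y (measure ν f) + ENNReal.ofReal (lam * ‖f‖)

/-- The set of global minimizers of the cost over `M(Ω)`. -/
def solutionSet (E : (Fin M → ℝ) → (Fin M → ℝ) → ℝ≥0∞) (y : Fin M → ℝ) (ν : Fin M → C(Ω, ℝ))
    (lam : ℝ) : Set (RadonSpace Ω) :=
  {f | ∀ g : RadonSpace Ω, cost E y ν lam f ≤ cost E y ν lam g}

/-- `f` is a sum of at most `N` weighted Dirac impulses. -/
def IsSpikeSum (N : ℕ) (f : RadonSpace Ω) : Prop :=
  ∃ K : ℕ, K ≤ N ∧ ∃ (a : Fin K → ℝ) (x : Fin K → Ω), f = ∑ k, a k • dirac (x k)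

end Spikes

end

open scoped ENNReal NNReal

noncomputable section

namespace Spikes

section NormedSpace

variable {X : Type*} [NormedAddCommGroup X] [NormedSpace ℝ X]

/-! Let `f` be an extreme minimizer of finite cost, and let `‖φ‖ ≤ 1` with `f (φ * ν m) = 0` for all
`m`. Then `(1 ± φ) • f` have the measurements of `f`, and their norms sum to at most `2‖f‖`. By
minimality both norms equal `‖f‖`, so both are minimizers with midpoint `f`, and extremality gives
`φ • f = 0` (`mem_nullIdeal_of_mem_extremePoints`). So `M` linear conditions on `φ` force `φ • f =
0`, which leaves at most `M` points in the support (`card_le_of_subset_supp`) and makes `f` a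
combination of Diracs there. Extreme points exist by Banach–Alaoglu and Krein–Milman. -/

theorem exists_norm_lt_one_lt_apply (A : StrongDual ℝ X) {r : ℝ} (hr : r < ‖A‖) :
    ∃ x : X, ‖x‖ < 1 ∧ r < A x := by
  obtain ⟨x, hx, hAx⟩ := A.exists_lt_apply_of_lt_opNorm hr
  rcases le_total 0 (A x) with h | h
  · exact ⟨x, hx, by rwa [Real.norm_of_nonneg h] at hAx⟩
  · exact ⟨-x, by rwa [norm_neg], by rwa [Real.norm_of_nonpos h, ← map_neg] at hAx⟩

/-- The two test vectors vary independently, so the suprema defining the norms add. -/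
theorem norm_add_norm_le_of_apply_add_apply_le (A B : StrongDual ℝ X) {C : ℝ}
    (h : ∀ x y : X, ‖x‖ ≤ 1 → ‖y‖ ≤ 1 → A x + B y ≤ C) : ‖A‖ + ‖B‖ ≤ C := by
  refine le_of_forall_pos_le_add fun ε hε => ?_
  obtain ⟨x, hx, hAx⟩ := exists_norm_lt_one_lt_apply A (sub_lt_self ‖A‖ (half_pos hε))
  obtain ⟨y, hy, hBy⟩ := exists_norm_lt_one_lt_apply B (sub_lt_self ‖B‖ (half_pos hε))
  linarith [h x y hx.le hy.le]

end NormedSpace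

variable {Ω : Type*} [TopologicalSpace Ω] [CompactSpace Ω] {M : ℕ}

/-- The measure `φ • f` with density `φ` with respect to `f`, i.e. the functional
`ψ ↦ f (φ * ψ)`. -/
def withDensity (f : RadonSpace Ω) (φ : C(Ω, ℝ)) : RadonSpace Ω :=
  f.comp (ContinuousLinearMap.mul ℝ C(Ω, ℝ) φ)

@[simp]
theorem withDensity_apply (f : RadonSpace Ω) (φ ψ : C(Ω, ℝ)) :
    withDensity f φ ψ = f (φ * ψ) := rfl

/-- Since `1 ± φ ≥ 0`, pointwise `|(1 + φ) * ψ₁ + (1 - φ) * ψ₂| ≤ (1 + φ) + (1 - φ) = 2`. -/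
theorem norm_withDensity_one_add_add_norm_withDensity_one_sub_le (f : RadonSpace Ω)
    {φ : C(Ω, ℝ)} (hφ : ‖φ‖ ≤ 1) :
    ‖withDensity f (1 + φ)‖ + ‖withDensity f (1 - φ)‖ ≤ 2 * ‖f‖ := by
  refine norm_add_norm_le_of_apply_add_apply_le _ _ fun ψ₁ ψ₂ h₁ h₂ => ?_
  have hnorm : ‖(1 + φ) * ψ₁ + (1 - φ) * ψ₂‖ ≤ 2 := by
    refine (ContinuousMap.norm_le _ zero_le_two).2 fun x => ?_
    have hx := abs_le.1 ((φ.norm_coe_le_norm x).trans hφ)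
    have hx₁ := abs_le.1 ((ψ₁.norm_coe_le_norm x).trans h₁)
    have hx₂ := abs_le.1 ((ψ₂.norm_coe_le_norm x).trans h₂)
    simp only [ContinuousMap.add_apply, ContinuousMap.mul_apply, ContinuousMap.sub_apply,
      ContinuousMap.one_apply, Real.norm_eq_abs]
    refine abs_le.2 ⟨?_, ?_⟩ <;> nlinarith
  calc withDensity f (1 + φ) ψ₁ + withDensity f (1 - φ) ψ₂
      = f ((1 + φ) * ψ₁ + (1 - φ) * ψ₂) := by simp only [withDensity_apply, map_add]
    _ ≤ ‖f‖ * ‖(1 + φ) * ψ₁ + (1 - φ) * ψ₂‖ := (le_abs_self _).trans (f.le_opNorm _)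
    _ ≤ 2 * ‖f‖ := by nlinarith [norm_nonneg f]

/-- The closed ideal of the densities `φ` with `φ • f = 0`. -/
def nullIdeal (f : RadonSpace Ω) : Ideal C(Ω, ℝ) where
  carrier := {φ | ∀ ψ, f (φ * ψ) = 0}
  add_mem' {a b} ha hb ψ := by rw [add_mul, map_add, ha ψ, hb ψ, add_zero]
  zero_mem' ψ := by rw [zero_mul, map_zero]
  smul_mem' c a ha ψ := by
    rw [smul_eq_mul, mul_comm c a, mul_assoc]
    exact ha (c * ψ)

theorem mem_nullIdeal {f : RadonSpace Ω} {φ : C(Ω, ℝ)} :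
    φ ∈ nullIdeal f ↔ ∀ ψ, f (φ * ψ) = 0 := Iff.rfl

theorem isClosed_nullIdeal (f : RadonSpace Ω) : IsClosed (nullIdeal f : Set C(Ω, ℝ)) := by
  have : (nullIdeal f : Set C(Ω, ℝ)) = ⋂ ψ, {φ | f (φ * ψ) = 0} := by
    ext φ
    simp [mem_nullIdeal]
  rw [this]
  exact isClosed_iInter fun ψ =>
    isClosed_eq (f.continuous.comp (continuous_id.mul continuous_const)) continuous_const

/-- The support of `f`, i.e. the common zero set of the densities `φ` with `φ • f = 0`. -/
def supp (f : RadonSpace Ω) : Set Ω := {x | ∀ φ ∈ nullIdeal f, φ x = 0}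

/-- A closed ideal of `C(Ω)` consists of all functions vanishing on its zero set, so `φ • f = 0`;
test this against `1`. -/
theorem apply_eq_zero_of_eqOn_supp [T2Space Ω] {f : RadonSpace Ω} {φ : C(Ω, ℝ)}
    (h : ∀ x ∈ supp f, φ x = 0) : f φ = 0 := by
  have hφ : φ ∈ ContinuousMap.idealOfSet ℝ (ContinuousMap.setOfIdeal (nullIdeal f)) :=
    ContinuousMap.mem_idealOfSet.2 fun x hx => h x (ContinuousMap.notMem_setOfIdeal.1 hx)
  rw [ContinuousMap.idealOfSet_ofIdeal_isClosed (isClosed_nullIdeal f)] at hφ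
  simpa using hφ 1

/-- A functional vanishing on the common kernel of finitely many others lies in their span. -/
theorem isSpikeSum_of_supp_subset [T2Space Ω] {f : RadonSpace Ω} {t : Finset Ω} {N : ℕ}
    (hf : supp f ⊆ t) (ht : t.card ≤ N) : IsSpikeSum N f := by
  have key : (f : C(Ω, ℝ) →ₗ[ℝ] ℝ) ∈ Submodule.span ℝ
      (Set.range fun k : Fin t.card => (dirac (t.equivFin.symm k : Ω) : C(Ω, ℝ) →ₗ[ℝ] ℝ)) := by
    refine mem_span_of_iInf_ker_le_ker fun φ hφ => ?_
    refine apply_eq_zero_of_eqOn_supp fun x hx => ?_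
    have := (Submodule.mem_iInf _).1 hφ (t.equivFin ⟨x, hf hx⟩)
    simpa [dirac_apply] using this
  obtain ⟨a, ha⟩ := (Submodule.mem_span_range_iff_exists_fun ℝ).1 key
  refine ⟨t.card, ht, a, fun k => t.equivFin.symm k, ?_⟩
  ext φ
  have := LinearMap.congr_fun ha φ
  simpa using this.symm

theorem linearIndependent_dirac [T2Space Ω] (t : Finset Ω) :
    LinearIndependent ℝ fun x : t => (dirac (x : Ω) : C(Ω, ℝ) →ₗ[ℝ] ℝ) := by
  classical
  refine linearIndependent_iff'.2 fun s c hc x hx => ?_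
  obtain ⟨φ, hφ₀, hφ₁, -⟩ := exists_continuous_zero_one_of_isClosed
    (t.erase x).finite_toSet.isClosed (isClosed_singleton (x := (x : Ω))) (by simp)
  have h := LinearMap.congr_fun hc φ
  simp only [LinearMap.sum_apply, LinearMap.smul_apply, ContinuousLinearMap.coe_coe, dirac_apply,
    LinearMap.zero_apply, smul_eq_mul] at h
  rw [Finset.sum_eq_single_of_mem x hx fun z _ hz => ?_, hφ₁ (Set.mem_singleton _)] at h
  · simpa using h
  · rw [hφ₀ (by simpa using Subtype.coe_injective.ne hz)]
    simp

/-- If finitely many linear conditions on `φ` imply `φ • f = 0`, then `f` has at most that many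
points in its support. -/
theorem card_le_of_subset_supp [T2Space Ω] {f : RadonSpace Ω} (L : Fin M → C(Ω, ℝ) →ₗ[ℝ] ℝ)
    (hL : ∀ φ, (∀ m, L m φ = 0) → φ ∈ nullIdeal f) {t : Finset Ω} (ht : ↑t ⊆ supp f) :
    t.card ≤ M := by
  -- A Dirac at a support point kills the null ideal, hence the common kernel of the `L m`.
  have hmem : ∀ x : t, (dirac (x : Ω) : C(Ω, ℝ) →ₗ[ℝ] ℝ) ∈ Submodule.span ℝ (Set.range L) :=
    fun x => mem_span_of_iInf_ker_le_ker fun φ hφ =>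
      ht x.2 φ (hL φ fun m => (Submodule.mem_iInf _).1 hφ m)
  have hspan : Set.range (fun x : t => (dirac (x : Ω) : C(Ω, ℝ) →ₗ[ℝ] ℝ)) ≤
      (Submodule.span ℝ (Set.range L) : Set _) := by
    rintro _ ⟨x, rfl⟩
    exact hmem x
  have : Fintype (Set.range L) := Fintype.ofFinite _
  have hcard := linearIndependent_le_span_aux' _ (linearIndependent_dirac t) (Set.range L) hspan
  rw [Fintype.card_coe] at hcard
  exact hcard.trans ((Fintype.card_range_le L).trans_eq (Fintype.card_fin M))

theorem isSpikeSum_of_forall_mem_nullIdeal [T2Space Ω] {f : RadonSpace Ω}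
    (L : Fin M → C(Ω, ℝ) →ₗ[ℝ] ℝ) (hL : ∀ φ, (∀ m, L m φ = 0) → φ ∈ nullIdeal f) :
    IsSpikeSum M f := by
  have hfin : (supp f).Finite := by
    by_contra hinf
    obtain ⟨t, ht, hcard⟩ := Set.Infinite.exists_subset_card_eq hinf (M + 1)
    have := card_le_of_subset_supp L hL ht
    omega
  exact isSpikeSum_of_supp_subset (t := hfin.toFinset) (by simp)
    (card_le_of_subset_supp L hL (by simp))

theorem isSpikeSum_zero (N : ℕ) : IsSpikeSum N (0 : RadonSpace Ω) :=
  ⟨0, N.zero_le, Fin.elim0, Fin.elim0, by simp⟩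

/-! ### Minimizers and extreme points -/

section Minimizers

variable {ν : Fin M → C(Ω, ℝ)} {E : (Fin M → ℝ) → (Fin M → ℝ) → ℝ≥0∞} {y : Fin M → ℝ} {lam : ℝ}

theorem cost_ne_top_iff {f : RadonSpace Ω} :
    cost E y ν lam f ≠ ∞ ↔ E y (measure ν f) ≠ ∞ := by
  simp [cost]

theorem solutionSet_eq_univ (h : ∀ f : RadonSpace Ω, E y (measure ν f) = ∞) :
    solutionSet E y ν lam = Set.univ :=
  Set.eq_univ_of_forall fun f g => by simp [cost, h]

/-- A minimizer of finite cost has the least norm among the measures with the same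
measurements. -/
theorem norm_le_of_mem_solutionSet (hlam : 0 < lam) {f g : RadonSpace Ω}
    (hf : f ∈ solutionSet E y ν lam) (hfin : E y (measure ν f) ≠ ∞)
    (hg : measure ν g = measure ν f) : ‖f‖ ≤ ‖g‖ := by
  have h := hf g
  rw [cost, cost, hg, ENNReal.add_le_add_iff_left hfin,
    ENNReal.ofReal_le_ofReal_iff (by positivity)] at h
  exact le_of_mul_le_mul_left h hlam

theorem mem_solutionSet_of_norm_le (hlam : 0 < lam) {f g : RadonSpace Ω}
    (hf : f ∈ solutionSet E y ν lam) (hg : measure ν g = measure ν f) (hgf : ‖g‖ ≤ ‖f‖) :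
    g ∈ solutionSet E y ν lam := by
  refine fun k => le_trans ?_ (hf k)
  rw [cost, cost, hg]
  gcongr

theorem mem_nullIdeal_of_mem_extremePoints (hlam : 0 < lam) {f : RadonSpace Ω}
    (hf : f ∈ Set.extremePoints ℝ (solutionSet E y ν lam)) (hfin : E y (measure ν f) ≠ ∞)
    {φ : C(Ω, ℝ)} (hφ : ‖φ‖ ≤ 1) (hν : ∀ m, f (φ * ν m) = 0) : φ ∈ nullIdeal f := by
  have h₁ : measure ν (withDensity f (1 + φ)) = measure ν f := by
    ext m
    simp [measure, add_mul, hν]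
  have h₂ : measure ν (withDensity f (1 - φ)) = measure ν f := by
    ext m
    simp [measure, sub_mul, hν]
  have hsum := norm_withDensity_one_add_add_norm_withDensity_one_sub_le f hφ
  have hle₁ := norm_le_of_mem_solutionSet hlam hf.1 hfin h₁
  have hle₂ := norm_le_of_mem_solutionSet hlam hf.1 hfin h₂
  have heq := hf.2 (mem_solutionSet_of_norm_le hlam hf.1 h₁ (by linarith))
    (mem_solutionSet_of_norm_le hlam hf.1 h₂ (by linarith))
    ⟨1 / 2, 1 / 2, by norm_num, by norm_num, by norm_num, by
      ext ψ
      simp [add_mul, sub_mul]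
      ring⟩
  intro ψ
  have := DFunLike.congr_fun heq ψ
  simpa [add_mul] using this

theorem isSpikeSum_of_mem_extremePoints [T2Space Ω] (hlam : 0 < lam) {f : RadonSpace Ω}
    (hf : f ∈ Set.extremePoints ℝ (solutionSet E y ν lam)) : IsSpikeSum M f := by
  by_cases hfin : E y (measure ν f) = ∞
  · have htop : ∀ g : RadonSpace Ω, E y (measure ν g) = ∞ := fun g => by
      by_contra hg
      exact cost_ne_top_iff.1 (ne_top_of_le_ne_top (cost_ne_top_iff.2 hg) (hf.1 g)) hfin
    rw [solutionSet_eq_univ htop] at hf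
    -- `f` is the midpoint of `0` and `2 • f`.
    have h0 : (0 : RadonSpace Ω) = f := hf.2 (Set.mem_univ 0) (Set.mem_univ ((2 : ℝ) • f))
      ⟨1 / 2, 1 / 2, by norm_num, by norm_num, by norm_num, by simp⟩
    exact h0 ▸ isSpikeSum_zero M
  · refine isSpikeSum_of_forall_mem_nullIdeal
      (fun m => (f : C(Ω, ℝ) →ₗ[ℝ] ℝ) ∘ₗ (LinearMap.mulRight ℝ (ν m))) fun φ hφ => ?_
    replace hφ : ∀ m, f (φ * ν m) = 0 := hφ
    have hpos : 0 < ‖φ‖ + 1 := by positivity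
    -- Rescaling into the unit ball; the `+ 1` covers `φ = 0`.
    have hmem : (‖φ‖ + 1)⁻¹ • φ ∈ nullIdeal f := by
      refine mem_nullIdeal_of_mem_extremePoints hlam hf hfin ?_ fun m => ?_
      · rw [norm_smul, norm_inv, Real.norm_of_nonneg hpos.le, inv_mul_le_iff₀ hpos]
        linarith
      · rw [smul_mul_assoc, map_smul, hφ, smul_zero]
    intro ψ
    have := hmem ψ
    rw [smul_mul_assoc, map_smul, smul_eq_zero] at this
    exact this.resolve_left (inv_ne_zero hpos.ne')

/-- The cost is weak-* lower semicontinuous. -/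
theorem lowerSemicontinuous_cost_toStrongDual (hE : LowerSemicontinuous (E y)) (hlam : 0 < lam) :
    LowerSemicontinuous fun f : WeakDual ℝ C(Ω, ℝ) =>
      cost E y ν lam (WeakDual.toStrongDual f) := by
  refine LowerSemicontinuous.add (hE.comp (continuous_pi fun m => WeakDual.eval_continuous (ν m)))
    (lowerSemicontinuous_iff_isClosed_preimage.2 fun c => ?_)
  by_cases hc : c = ∞
  · simp [hc]
  -- Sublevel sets of the norm term are dual balls, which are weak-* closed.
  · convert WeakDual.isClosed_closedBall (0 : RadonSpace Ω) (c.toReal / lam) using 1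
    ext f
    simp [ENNReal.ofReal_le_iff_le_toReal hc, le_div_iff₀' hlam]

theorem norm_le_of_cost_le (hlam : 0 < lam) {f : RadonSpace Ω} {c : ℝ≥0∞} (hc : c ≠ ∞)
    (h : cost E y ν lam f ≤ c) : ‖f‖ ≤ c.toReal / lam := by
  rw [le_div_iff₀' hlam]
  exact (ENNReal.ofReal_le_iff_le_toReal hc).1 (le_add_self.trans h)

/-- Any `g` at least as good as `f₀` lies in a fixed weak-* compact ball, where the lower
semicontinuous cost attains its minimum. -/
theorem solutionSet_nonempty (hE : LowerSemicontinuous (E y)) (hlam : 0 < lam)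
    {f₀ : RadonSpace Ω} (hf₀ : E y (measure ν f₀) ≠ ∞) : (solutionSet E y ν lam).Nonempty := by
  have hc := cost_ne_top_iff (lam := lam).2 hf₀
  obtain ⟨f, hf, hmin⟩ := LowerSemicontinuousOn.exists_isMinOn
    ⟨StrongDual.toWeakDual f₀, by simpa using norm_le_of_cost_le hlam hc le_rfl⟩
    (WeakDual.isCompact_closedBall (0 : RadonSpace Ω) ((cost E y ν lam f₀).toReal / lam))
    ((lowerSemicontinuous_cost_toStrongDual (ν := ν) hE hlam).lowerSemicontinuousOn _)
  have hmin' : ∀ g : RadonSpace Ω, ‖g‖ ≤ (cost E y ν lam f₀).toReal / lam →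
      cost E y ν lam (WeakDual.toStrongDual f) ≤ cost E y ν lam g := fun g hg =>
    isMinOn_iff.1 hmin (StrongDual.toWeakDual g) (by simpa using hg)
  refine ⟨WeakDual.toStrongDual f, fun g => ?_⟩
  rcases le_total (cost E y ν lam g) (cost E y ν lam f₀) with h | h
  · exact hmin' g (norm_le_of_cost_le hlam hc h)
  · exact (hmin' f₀ (norm_le_of_cost_le hlam hc le_rfl)).trans h

theorem extremePoints_solutionSet_nonempty (hE : LowerSemicontinuous (E y)) (hlam : 0 < lam)
    {f₀ : RadonSpace Ω} (hf₀ : E y (measure ν f₀) ≠ ∞) :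
    (Set.extremePoints ℝ (solutionSet E y ν lam)).Nonempty := by
  obtain ⟨f₁, hf₁⟩ := solutionSet_nonempty hE hlam hf₀
  have hc : cost E y ν lam f₀ ≠ ∞ := cost_ne_top_iff.2 hf₀
  set S : Set (WeakDual ℝ C(Ω, ℝ)) := WeakDual.toStrongDual ⁻¹' solutionSet E y ν lam with hS
  have hclosed : IsClosed S := by
    have : S = ⋂ g, (fun f : WeakDual ℝ C(Ω, ℝ) => cost E y ν lam (WeakDual.toStrongDual f)) ⁻¹'
        Set.Iic (cost E y ν lam g) := by
      ext f
      simp [hS, solutionSet]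
    rw [this]
    exact isClosed_iInter fun g =>
      (lowerSemicontinuous_cost_toStrongDual hE hlam).isClosed_preimage _
  have hcompact : IsCompact S :=
    (WeakDual.isCompact_closedBall (0 : RadonSpace Ω)
      ((cost E y ν lam f₀).toReal / lam)).of_isClosed_subset hclosed fun f hf => by
        simpa using norm_le_of_cost_le hlam hc (hf f₀)
  have : LocallyConvexSpace ℝ (WeakDual ℝ C(Ω, ℝ)) :=
    (WeakDual.withSeminorms ℝ C(Ω, ℝ)).toLocallyConvexSpace
  obtain ⟨f, hfS, hf⟩ := hcompact.extremePoints_nonempty ⟨StrongDual.toWeakDual f₁, hf₁⟩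
  exact ⟨WeakDual.toStrongDual f, hfS, fun g hg k hk hfgk => hf hg hk hfgk⟩

end Minimizers

end Spikes

end


theorem mainTheorem5 {Ω : Type*} [TopologicalSpace Ω] [CompactSpace Ω] [T2Space Ω] {M : ℕ}
    (ν : Fin M → C(Ω, ℝ))
    (E : (Fin M → ℝ) → (Fin M → ℝ) → ℝ≥0∞) (y : Fin M → ℝ)
    (hE_convex : ConvexOn ℝ≥0 Set.univ (E y)) (hE_lsc : LowerSemicontinuous (E y))
    (lam : ℝ) (hlam : 0 < lam) :
    -- every extreme point of the solution set is a sum of at most `M` spikes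
    (∀ f ∈ Set.extremePoints ℝ (Spikes.solutionSet E y ν lam), Spikes.IsSpikeSum M f) ∧
    -- extreme points exist as soon as the cost is not identically infinite
    ((∃ f : Spikes.RadonSpace Ω, E y (Spikes.measure ν f) ≠ ∞) →
      (Set.extremePoints ℝ (Spikes.solutionSet E y ν lam)).Nonempty) ∧
    -- there is a minimizer that is a sum of at most `M` spikes
    (∃ f ∈ Spikes.solutionSet E y ν lam, Spikes.IsSpikeSum M f) := by
  have hext : ∀ f ∈ Set.extremePoints ℝ (Spikes.solutionSet E y ν lam), Spikes.IsSpikeSum M f :=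
    fun f hf => Spikes.isSpikeSum_of_mem_extremePoints hlam hf
  have hne : (∃ f : Spikes.RadonSpace Ω, E y (Spikes.measure ν f) ≠ ∞) →
      (Set.extremePoints ℝ (Spikes.solutionSet E y ν lam)).Nonempty :=
    fun ⟨_, hf₀⟩ => Spikes.extremePoints_solutionSet_nonempty hE_lsc hlam hf₀
  refine ⟨hext, hne, ?_⟩
  by_cases h : ∃ f : Spikes.RadonSpace Ω, E y (Spikes.measure ν f) ≠ ∞
  · obtain ⟨f, hf⟩ := hne h
    exact ⟨f, hf.1, hext f hf⟩
  · push Not at h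
    -- With cost identically infinite, the empty sum is a minimizer.
    exact ⟨0, by simp [Spikes.solutionSet_eq_univ h], Spikes.isSpikeSum_zero M⟩
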